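/- Let $n\ge 1$ and let $p_1,\dots,p_n>0$ with $\sum_i p_i=1$. On a probability space with a filtration $(\mathcal F_t)_{t\ge 0}$, let $G_t=([n],E_t)$, $t=0,1,2,\dots$, be random simple undirected graphs on $[n]=\{1,\dots,n\}$, let $U_t\in[n]$ be the agent selected at time $t$, and let $x_i(t)\in\mathbb R$ be the state of agent $i$ at time $t$. Write $N_i(t)=\{j\in[n] : j=i \text{ or } \{i,j\}\in E_t\}$ for the closed neighbourhood of $i$ in $G_t$. Assume: 1. the initial states $x_i(0)$ are $\mathcal F_0$-measurable with $\mathbb E[x_i(0)^2]<\infty$; $G_t$ is $\mathcal F_t$-measurable and $U_t$ is $\mathcal F_{t+1}$-measurable for every $t$; 2. for every $t$, $U_t$ is independent of $\mathcal F_t$ (in particular of the initial states, of $G_0,\dots,G_t$ and of $U_0,\dots,U_{t-1}$), and $\mathbb P(U_t=i)=p_i$ for all $i\in[n]$; 3. for every $t$, the selected agent $i=U_t$ updates to $$x_i(t+1)=\frac{1}{|N_i(t)|}\sum_{j\in N_i(t)}x_j(t),$$ while $x_j(t+1)=x_j(t)$ for all $j\ne U_t$; 4. for every $t$, the neighbourhood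 of the selected agent $i=U_t$ can only contract, $N_i(t+1)\subseteq N_i(t)$; the edges between non-selected agents may be added or removed arbitrarily. If, almost surely, $G_t$ is connected for infinitely many $t$, then there is a random variable $x_\infty$ such that, almost surely, $$\lim_{t\to\infty}x_i(t)=x_\infty\quad\text{for all } i\in[n].$$ -/

import Mathlib

open MeasureTheory ProbabilityTheory Filter Topology
open scoped ENNReal

open Classical in
/-- The closed neighbourhood of agent `i` in the graph `G`: `i` itself together with all agents
adjacent to it. -/
noncomputable def closedNbhd {n : ℕ} (G : SimpleGraph (Fin n)) (i : Fin n) : Finset (Fin n) :=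
  Finset.univ.filter fun j => j = i ∨ G.Adj i j

/-- Asynchronous averaging on a dynamic graph with selective neighbourhood contraction.

`U t` is the agent selected at time `t`, `G t` the network at time `t`, and `x t ω i` the state of
agent `i` at time `t`. The filtration `ℱ` is the information available: `ℱ t` contains the initial
states, the networks up to and including time `t`, and the agents selected strictly before time `t`
(it may contain more, such as extra randomness used by the agents to rewire). -/
structure IsAsyncAveraging {n : ℕ} {Ω : Type*} [mΩ : MeasurableSpace Ω] (μ : Measure Ω)
    (p : Fin n → ℝ) (ℱ : Filtration ℕ mΩ) (G : ℕ → Ω → SimpleGraph (Fin n))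
    (U : ℕ → Ω → Fin n) (x : ℕ → Ω → Fin n → ℝ) : Prop where
  /-- The initial states are random variables known at time `0`. -/
  measurable_init : ∀ i, Measurable[ℱ 0] fun ω => x 0 ω i
  /-- The initial states have finite second moment. -/
  memLp_init : ∀ i, MemLp (fun ω => x 0 ω i) 2 μ
  /-- The network at time `t` is random, and known at time `t`. -/
  measurable_graph : ∀ t i j, MeasurableSet[ℱ t] {ω | (G t ω).Adj i j}
  /-- The agent selected at time `t` is known at time `t + 1`. -/
  measurable_select : ∀ t, Measurable[ℱ (t + 1)] (U t)
  /-- The selection at time `t` is independent of the information available at time `t`. -/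
  indep_select : ∀ t, Indep (MeasurableSpace.comap (U t) ⊤) (ℱ t) μ
  /-- At each time, agent `i` is selected with probability `p i`. -/
  prob_select : ∀ t i, μ.real {ω | U t ω = i} = p i
  /-- The selection probabilities are positive. -/
  prob_pos : ∀ i, 0 < p i
  /-- The selected agent moves to the average over its closed neighbourhood. -/
  update_selected : ∀ t ω, x (t + 1) ω (U t ω) =
    (∑ j ∈ closedNbhd (G t ω) (U t ω), x t ω j) / ((closedNbhd (G t ω) (U t ω)).card : ℝ)
  /-- All other agents keep their states. -/
  update_other : ∀ t ω i, i ≠ U t ω → x (t + 1) ω i = x t ω i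
  /-- The neighbourhood of the selected agent can only shrink; the rest of the network may change
  arbitrarily. -/
  contract : ∀ t ω, closedNbhd (G (t + 1) ω) (U t ω) ⊆ closedNbhd (G t ω) (U t ω)

/-! The largest value never increases and the smallest never decreases; call their limits `M` and
`m`, and suppose `m < M`. Take `m < a < M` and `c` slightly above `M`. Some agent always lies below
`a`, and eventually all lie below `c`. If infinitely often `k < n` agents lie below `c - δ`, then
infinitely often `k + 1` lie below `c - δ / n`. Indeed, otherwise connectivity forces edges across
the level infinitely often (`frequently_crossing`), some fixed upper endpoint is selected at
infinitely many of these times, and averaging pulls it below `c - δ / n`. After `n - 1` rounds all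
agents lie below a level less than `M`, which is absurd. Chance enters only through the selections:
by Lévy's conditional Borel–Cantelli lemma, an adapted event occurring infinitely often coincides
infinitely often with the selection of a given agent (`ae_frequently_and_eq_of_frequently`). -/

/-! ### Deterministic averaging trajectories -/

/-- A single trajectory of the asynchronous averaging dynamics: at time `t` the agent `U t` moves to
the average over its closed neighbourhood in `G t`, and the other agents keep their states. -/
structure IsAveragingPath {n : ℕ} (G : ℕ → SimpleGraph (Fin n)) (U : ℕ → Fin n)
    (y : ℕ → Fin n → ℝ) : Prop where
  update_selected : ∀ t, y (t + 1) (U t) =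
    (∑ j ∈ closedNbhd (G t) (U t), y t j) / ((closedNbhd (G t) (U t)).card : ℝ)
  update_other : ∀ t i, i ≠ U t → y (t + 1) i = y t i

theorem mem_closedNbhd {n : ℕ} {G : SimpleGraph (Fin n)} {i j : Fin n} :
    j ∈ closedNbhd G i ↔ j = i ∨ G.Adj i j := by
  simp [closedNbhd]

theorem self_mem_closedNbhd {n : ℕ} (G : SimpleGraph (Fin n)) (i : Fin n) :
    i ∈ closedNbhd G i :=
  mem_closedNbhd.2 (Or.inl rfl)

theorem card_closedNbhd_pos {n : ℕ} (G : SimpleGraph (Fin n)) (i : Fin n) :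
    (0 : ℝ) < (closedNbhd G i).card :=
  Nat.cast_pos.2 (Finset.card_pos.2 ⟨i, self_mem_closedNbhd G i⟩)

/-- The agents whose value is at most `r`. -/
noncomputable def lowerAgents {n : ℕ} (y : Fin n → ℝ) (r : ℝ) : Finset (Fin n) :=
  Finset.univ.filter fun i => y i ≤ r

theorem mem_lowerAgents {n : ℕ} {y : Fin n → ℝ} {r : ℝ} {i : Fin n} :
    i ∈ lowerAgents y r ↔ y i ≤ r := by
  simp [lowerAgents]

theorem lowerAgents_mono {n : ℕ} (y : Fin n → ℝ) : Monotone (lowerAgents y) := by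
  intro r s h i hi
  exact mem_lowerAgents.2 ((mem_lowerAgents.1 hi).trans h)

/-- A connected graph has an edge leaving every proper nonempty set of vertices. -/
theorem SimpleGraph.Connected.exists_adj_mem_notMem {V : Type*} {G : SimpleGraph V}
    (hG : G.Connected) {S : Set V} {a b : V} (ha : a ∈ S) (hb : b ∉ S) :
    ∃ u v, u ∉ S ∧ v ∈ S ∧ G.Adj u v := by
  obtain ⟨w⟩ := hG.preconnected a b
  obtain ⟨d, -, h1, h2⟩ := w.exists_boundary_dart S ha hb
  exact ⟨d.snd, d.fst, h2, h1, d.adj.symm⟩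

namespace IsAveragingPath

variable {n : ℕ} {G : ℕ → SimpleGraph (Fin n)} {U : ℕ → Fin n} {y : ℕ → Fin n → ℝ}

theorem neg (h : IsAveragingPath G U y) : IsAveragingPath G U (fun t i => -y t i) where
  update_selected t := by
    rw [h.update_selected t, Finset.sum_neg_distrib, neg_div]
  update_other t i hi := by rw [h.update_other t i hi]

theorem selected_le (h : IsAveragingPath G U y) {t : ℕ} {b : ℝ}
    (hb : ∀ j ∈ closedNbhd (G t) (U t), y t j ≤ b) : y (t + 1) (U t) ≤ b := by
  rw [h.update_selected t, div_le_iff₀ (card_closedNbhd_pos _ _)]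
  calc ∑ j ∈ closedNbhd (G t) (U t), y t j
      ≤ ∑ _j ∈ closedNbhd (G t) (U t), b := Finset.sum_le_sum hb
    _ = b * (closedNbhd (G t) (U t)).card := by rw [Finset.sum_const, nsmul_eq_mul, mul_comm]

/-- An upper bound on a set of agents without edges leaving it is preserved by a step. -/
theorem le_succ_of_no_exit (h : IsAveragingPath G U y) {t : ℕ} {b : ℝ} {S : Finset (Fin n)}
    (hb : ∀ j ∈ S, y t j ≤ b) (hS : ∀ u v, u ∉ S → v ∈ S → ¬ (G t).Adj u v) :
    ∀ j ∈ S, y (t + 1) j ≤ b := by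
  intro j hj
  by_cases hjU : j = U t
  · subst hjU
    refine h.selected_le fun k hk => hb k ?_
    rcases mem_closedNbhd.1 hk with rfl | hadj
    · exact hj
    · by_contra hkS
      exact hS k _ hkS hj hadj.symm
  · rw [h.update_other t j hjU]
    exact hb j hj

theorem le_of_le (h : IsAveragingPath G U y) {s : ℕ} {b : ℝ} (hb : ∀ j, y s j ≤ b) :
    ∀ t, s ≤ t → ∀ j, y t j ≤ b := by
  intro t hst
  induction t, hst using Nat.le_induction with
  | base => exact hb
  | succ t _ ih =>
    intro j
    exact h.le_succ_of_no_exit (S := Finset.univ) (fun j _ => ih j)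
      (fun u _ hu => absurd (Finset.mem_univ u) hu) j (Finset.mem_univ j)

/-- If the selected agent has a neighbour at distance at least `δ` below the common upper bound `c`,
then it lands at distance at least `δ / n` below `c`. -/
theorem selected_le_sub_div (h : IsAveragingPath G U y) {t : ℕ} {c δ : ℝ} {v : Fin n}
    (hδ : 0 ≤ δ) (hc : ∀ j, y t j ≤ c) (hv : v ∈ closedNbhd (G t) (U t)) (hvδ : y t v ≤ c - δ) :
    y (t + 1) (U t) ≤ c - δ / n := by
  set N := closedNbhd (G t) (U t) with hN
  have hNpos : (0 : ℝ) < N.card := card_closedNbhd_pos _ _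
  have hNn : (N.card : ℝ) ≤ n := by
    exact_mod_cast (Finset.card_le_univ N).trans_eq (Fintype.card_fin n)
  have hsum : ∑ j ∈ N, y t j ≤ c * N.card - δ := by
    -- All deficits below `c` are nonnegative, and that of `v` alone is at least `δ`.
    have h1 : δ ≤ ∑ j ∈ N, (c - y t j) :=
      (by linarith : δ ≤ c - y t v).trans
        (Finset.single_le_sum (f := fun j => c - y t j)
          (fun j _ => sub_nonneg.2 (hc j)) hv)
    rw [Finset.sum_sub_distrib, Finset.sum_const, nsmul_eq_mul] at h1
    linarith
  rw [h.update_selected t, ← hN, div_le_iff₀ hNpos]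
  have h2 : δ / n * N.card ≤ δ := by
    rw [div_mul_eq_mul_div]
    exact div_le_of_le_mul₀ (Nat.cast_nonneg n) hδ (mul_le_mul_of_nonneg_left hNn hδ)
  linarith

/-- If an agent above the level `c - δ` with a neighbour below that level is selected, then the
number of agents below the level `c - δ / n` grows. -/
theorem card_lowerAgents_succ (h : IsAveragingPath G U y) {t : ℕ} {c δ : ℝ} {v : Fin n}
    (hδ : 0 ≤ δ) (hc : ∀ j, y t j ≤ c) (hu : c - δ < y t (U t)) (hv : y t v ≤ c - δ)
    (hadj : (G t).Adj (U t) v) :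
    (lowerAgents (y t) (c - δ)).card + 1 ≤ (lowerAgents (y (t + 1)) (c - δ / n)).card := by
  have hn : (1 : ℝ) ≤ n := by exact_mod_cast (U t).pos
  have hnotMem : U t ∉ lowerAgents (y t) (c - δ) := fun hm => (mem_lowerAgents.1 hm).not_gt hu
  rw [← Finset.card_cons hnotMem]
  refine Finset.card_le_card fun i hi => mem_lowerAgents.2 ?_
  rcases Finset.mem_cons.1 hi with rfl | hi
  · exact h.selected_le_sub_div hδ hc (mem_closedNbhd.2 (Or.inr hadj)) hv
  · have hiU : i ≠ U t := fun e => hnotMem (e ▸ hi)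
    rw [h.update_other t i hiU]
    have := mem_lowerAgents.1 hi
    have : δ / n ≤ δ := div_le_self hδ hn
    linarith

/-- If infinitely often at least `k` agents are below the level `r`, but eventually no more than `k`
agents are, and the network is connected infinitely often, then infinitely often there is an edge
between an agent above level `r` and one below, while `k` agents are below. -/
theorem frequently_crossing (h : IsAveragingPath G U y) {r : ℝ} {k : ℕ} (hk : 0 < k) (hkn : k < n)
    (hconn : ∃ᶠ t in atTop, (G t).Connected)
    (hfreq : ∃ᶠ t in atTop, k ≤ (lowerAgents (y t) r).card)
    (hle : ∀ᶠ t in atTop, (lowerAgents (y t) r).card ≤ k) :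
    ∃ᶠ t in atTop, k ≤ (lowerAgents (y t) r).card ∧
      ∃ u v, r < y t u ∧ y t v ≤ r ∧ (G t).Adj u v := by
  rw [frequently_atTop]
  intro a
  by_contra! hno
  obtain ⟨b, hb⟩ := eventually_atTop.1 hle
  obtain ⟨s, hs, hks⟩ := frequently_atTop.1 hfreq (max a b)
  have has := (le_max_left a b).trans hs
  have hbs := (le_max_right a b).trans hs
  set S := lowerAgents (y s) r with hS
  -- Without crossing edges the lower set loses nobody, and the cap `k` lets nobody join.
  have hconst : ∀ t, s ≤ t → lowerAgents (y t) r = S := by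
    intro t hst
    induction t, hst using Nat.le_induction with
    | base => rfl
    | succ t hst ih =>
      have hnocross := hno t (has.trans hst) (by rw [ih]; exact hks)
      refine (Finset.eq_of_subset_of_card_le (fun j hj => mem_lowerAgents.2 ?_) ?_).symm
      · refine h.le_succ_of_no_exit (S := S) (fun j hj => ?_) (fun u v hu hv => ?_) j hj
        · exact mem_lowerAgents.1 (ih ▸ hj)
        · rw [← ih, mem_lowerAgents] at hu hv
          exact hnocross u v (not_le.1 hu) hv
      · exact (hb (t + 1) (by omega)).trans hks
  obtain ⟨t, hst, hGt⟩ := frequently_atTop.1 hconn s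
  obtain ⟨i, hi⟩ := Finset.card_pos.1 (hk.trans_le hks)
  obtain ⟨j, hj⟩ : ∃ j, j ∉ S := by
    by_contra! hall
    have : S.card = n := by
      rw [Finset.eq_univ_iff_forall.2 hall, Finset.card_fin]
    have : S.card ≤ k := hb s hbs
    omega
  obtain ⟨u, v, hu, hv, hadj⟩ := hGt.exists_adj_mem_notMem (S := (S : Set (Fin n))) hi hj
  rw [← hconst t hst, Finset.mem_coe, mem_lowerAgents] at hu hv
  exact hno t (has.trans hst) (by rw [hconst t hst]; exact hks) u v (not_le.1 hu) hv hadj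

/-- If every crossing edge that is present infinitely often gets its upper agent selected infinitely
often, then the number of agents below the level increases, at the price of a higher level. -/
theorem frequently_card_lowerAgents_succ (h : IsAveragingPath G U y) {c δ : ℝ} {k : ℕ}
    (hδ : 0 ≤ δ) (hk : 0 < k) (hkn : k < n) (hc : ∀ᶠ t in atTop, ∀ j, y t j ≤ c)
    (hconn : ∃ᶠ t in atTop, (G t).Connected)
    (hsel : ∀ u,
      (∃ᶠ t in atTop, k ≤ (lowerAgents (y t) (c - δ)).card ∧ c - δ < y t u ∧
        ∃ v, y t v ≤ c - δ ∧ (G t).Adj u v) →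
      ∃ᶠ t in atTop, (k ≤ (lowerAgents (y t) (c - δ)).card ∧ c - δ < y t u ∧
        ∃ v, y t v ≤ c - δ ∧ (G t).Adj u v) ∧ U t = u)
    (hfreq : ∃ᶠ t in atTop, k ≤ (lowerAgents (y t) (c - δ)).card) :
    ∃ᶠ t in atTop, k + 1 ≤ (lowerAgents (y t) (c - δ / n)).card := by
  intro hnot
  have hn : (1 : ℝ) ≤ n := by exact_mod_cast (show 1 ≤ n by omega)
  have hle : ∀ᶠ t in atTop, (lowerAgents (y t) (c - δ)).card ≤ k := by
    filter_upwards [hnot] with t ht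
    have : (lowerAgents (y t) (c - δ)).card ≤ (lowerAgents (y t) (c - δ / n)).card :=
      Finset.card_le_card (lowerAgents_mono _ (by linarith [div_le_self hδ hn]))
    omega
  have hcross := h.frequently_crossing hk hkn hconn hfreq hle
  -- Pigeonhole over the finitely many upper endpoints.
  obtain ⟨u, hu⟩ : ∃ u, ∃ᶠ t in atTop, k ≤ (lowerAgents (y t) (c - δ)).card ∧ c - δ < y t u ∧
      ∃ v, y t v ≤ c - δ ∧ (G t).Adj u v := by
    by_contra! hall
    refine hcross ?_
    filter_upwards [eventually_all.2 hall] with t ht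
    rintro ⟨hkt, u, v, hu, hv, hadj⟩
    exact ht u hkt hu v hv hadj
  obtain ⟨t, ⟨⟨⟨hkt, hut, v, hv, hadj⟩, rfl⟩, hct⟩, hnt⟩ :=
    (((hsel u hu).and_eventually hc).and_eventually
      ((tendsto_add_atTop_nat 1).eventually hnot)).exists
  exact hnt ((Nat.add_le_add_right hkt 1).trans (h.card_lowerAgents_succ hδ hct hut hv hadj))

/-- Consensus along a trajectory, provided that agents at the upper end of a crossing edge which
is present infinitely often are selected infinitely often, for all rational levels. -/
theorem exists_tendsto (h : IsAveragingPath G U y) (hn : 0 < n)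
    (hconn : ∃ᶠ t in atTop, (G t).Connected)
    (hsel : ∀ (r : ℚ) (k : ℕ) (u : Fin n),
      (∃ᶠ t in atTop, k ≤ (lowerAgents (y t) r).card ∧ (r : ℝ) < y t u ∧
        ∃ v, y t v ≤ r ∧ (G t).Adj u v) →
      ∃ᶠ t in atTop, (k ≤ (lowerAgents (y t) r).card ∧ (r : ℝ) < y t u ∧
        ∃ v, y t v ≤ r ∧ (G t).Adj u v) ∧ U t = u) :
    ∃ l, ∀ i, Tendsto (fun t => y t i) atTop (𝓝 l) := by
  have : NeZero n := ⟨hn.ne'⟩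
  have hle_sup : ∀ t i, y t i ≤ ⨆ j, y t j := fun t i => le_ciSup (Finite.bddAbove_range _) i
  have hinf_le : ∀ t i, ⨅ j, y t j ≤ y t i := fun t i => ciInf_le (Finite.bddBelow_range _) i
  have hanti : Antitone fun t => ⨆ j, y t j := fun s t hst =>
    ciSup_le (h.le_of_le (hle_sup s) t hst)
  have hmono : Monotone fun t => ⨅ j, y t j := fun s t hst =>
    le_ciInf fun j => by
      have := h.neg.le_of_le (b := -⨅ j, y s j) (fun j => neg_le_neg (hinf_le s j)) t hst j
      exact neg_le_neg_iff.1 this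
  have hinf_sup : ∀ s t, ⨅ j, y s j ≤ ⨆ j, y t j := fun s t =>
    (hmono (le_max_left s t)).trans (((hinf_le _ 0).trans (hle_sup _ 0)).trans
      (hanti (le_max_right s t)))
  have hbelow : BddBelow (Set.range fun t => ⨆ j, y t j) :=
    ⟨⨅ j, y 0 j, by rintro _ ⟨t, rfl⟩; exact hinf_sup 0 t⟩
  have habove : BddAbove (Set.range fun t => ⨅ j, y t j) :=
    ⟨⨆ j, y 0 j, by rintro _ ⟨t, rfl⟩; exact hinf_sup t 0⟩
  have hM := tendsto_atTop_ciInf hanti hbelow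
  have hm := tendsto_atTop_ciSup hmono habove
  set M := ⨅ t, ⨆ j, y t j with hMdef
  set m := ⨆ t, ⨅ j, y t j with hmdef
  have hmM : m ≤ M := le_of_tendsto_of_tendsto' hm hM fun t => hinf_sup t t
  rcases hmM.eq_or_lt with heq | hlt
  · refine ⟨M, fun i => tendsto_of_tendsto_of_tendsto_of_le_of_le (heq ▸ hm) hM
      (fun t => hinf_le t i) (fun t => hle_sup t i)⟩
  exfalso
  have hn1 : (0 : ℝ) < n := by exact_mod_cast hn
  have hpow : (0 : ℝ) < (n : ℝ) ^ (n - 1) := pow_pos hn1 _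
  -- Rational `a` and `c` keep every level `c - (c - a) / n ^ k` rational, as `hsel` requires.
  obtain ⟨a, hma, haM⟩ := exists_rat_btwn hlt
  -- choose `c` slightly above `M`, so that `c - (c - a) / n ^ (n - 1) < M`
  obtain ⟨c, hMc, hcM⟩ := exists_rat_btwn
    (show M < M + (M - a) / (n : ℝ) ^ (n - 1) from
      lt_add_of_pos_right _ (div_pos (sub_pos.2 haM) hpow))
  have hca : (0 : ℝ) ≤ c - a := by linarith
  have hc : ∀ᶠ t in atTop, ∀ j, y t j ≤ c := by
    filter_upwards [hM.eventually_lt_const hMc] with t ht j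
    exact (hle_sup t j).trans ht.le
  have key : ∀ k, k < n → ∃ᶠ t in atTop,
      k + 1 ≤ (lowerAgents (y t) ((c : ℝ) - (c - a) / (n : ℝ) ^ k)).card := by
    intro k
    induction k with
    | zero =>
      refine fun _ => Eventually.frequently (Eventually.of_forall fun t => ?_)
      obtain ⟨i, hi⟩ := exists_eq_ciInf_of_finite (f := y t)
      refine Finset.card_pos.2 ⟨i, mem_lowerAgents.2 ?_⟩
      rw [hi, pow_zero, div_one, sub_sub_cancel]
      exact (le_ciSup habove t).trans hma.le
    | succ k ih =>
      intro hk
      have hcast : (((c - (c - a) / (n : ℚ) ^ k : ℚ)) : ℝ) = (c : ℝ) - (c - a) / (n : ℝ) ^ k := by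
        push_cast; rfl
      have hsel' := hsel (c - (c - a) / (n : ℚ) ^ k) (k + 1)
      rw [hcast] at hsel'
      have := h.frequently_card_lowerAgents_succ (div_nonneg hca (pow_pos hn1 k).le) k.succ_pos hk
        hc hconn hsel' (ih (by omega))
      rwa [div_div, ← pow_succ] at this
  obtain ⟨t, ht⟩ := (key (n - 1) (by omega)).exists
  have huniv : lowerAgents (y t) ((c : ℝ) - (c - a) / (n : ℝ) ^ (n - 1)) = Finset.univ :=
    Finset.eq_univ_of_card _ (le_antisymm (Finset.card_le_univ _) (by
      rw [Fintype.card_fin]; omega))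
  have hsup : M ≤ (c : ℝ) - (c - a) / (n : ℝ) ^ (n - 1) :=
    (ciInf_le hbelow t).trans (ciSup_le fun j => mem_lowerAgents.1 (huniv ▸ Finset.mem_univ j))
  have : (M - a) / (n : ℝ) ^ (n - 1) ≤ (c - a) / (n : ℝ) ^ (n - 1) := by gcongr
  linarith

end IsAveragingPath

/-! ### Selections along an adapted sequence of events -/

/-- If the event `{U t = u}` is independent of `ℱ t` with probability `q > 0` for every `t`, then
almost surely `U t = u` for infinitely many of the times at which `A t` occurs, as long as the
adapted events `A t` occur infinitely often. -/
theorem ae_frequently_and_eq_of_frequently {Ω α : Type*} [MeasurableSpace α]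
    [MeasurableSingletonClass α] [mΩ : MeasurableSpace Ω]
    (μ : Measure Ω) [IsProbabilityMeasure μ] (ℱ : Filtration ℕ mΩ) {U : ℕ → Ω → α} {u : α} {q : ℝ}
    (hU : ∀ t, Measurable[ℱ (t + 1)] (U t))
    (hindep : ∀ t, Indep (MeasurableSpace.comap (U t) ⊤) (ℱ t) μ)
    (hprob : ∀ t, μ.real {ω | U t ω = u} = q) (hq : 0 < q)
    {A : ℕ → Set Ω} (hA : ∀ t, MeasurableSet[ℱ t] (A t)) :
    ∀ᵐ ω ∂μ, (∃ᶠ t in atTop, ω ∈ A t) → ∃ᶠ t in atTop, ω ∈ A t ∧ U t ω = u := by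
  set B : ℕ → Set Ω := fun t => {ω | U t ω = u} with hB
  have hBmeas : ∀ t, MeasurableSet[ℱ (t + 1)] (B t) := fun t =>
    (hU t) (measurableSet_singleton u)
  have hBm : ∀ t, MeasurableSet (B t) := fun t => ℱ.le _ _ (hBmeas t)
  -- The shift by one makes `s` adapted, since `U t` is known only at time `t + 1`.
  set s : ℕ → Set Ω := fun t => Nat.casesOn t ∅ fun t => A t ∩ B t with hs
  have hsmeas : ∀ t, MeasurableSet[ℱ t] (s t) := by
    rintro (_ | t)
    · exact @MeasurableSet.empty _ (ℱ 0)
    · exact @MeasurableSet.inter _ (ℱ (t + 1)) _ _ (ℱ.mono (Nat.le_succ t) _ (hA t)) (hBmeas t)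
  have hcond : ∀ t, μ[(s (t + 1)).indicator (1 : Ω → ℝ) | ℱ t] =ᵐ[μ]
      (A t).indicator fun _ => q := by
    intro t
    have hint : Integrable ((B t).indicator (1 : Ω → ℝ)) μ :=
      (integrable_const (1 : ℝ)).indicator (hBm t)
    -- The σ-algebra `⊤` on `α` may exceed the given one, so its pullback need not lie in `mΩ`.
    have hU' : MeasurableSpace.comap (U t) ⊤ ⊓ mΩ ≤ mΩ := inf_le_right
    have h1 : μ[(B t).indicator (1 : Ω → ℝ) | ℱ t] =ᵐ[μ] fun _ => q := by
      have hsm : StronglyMeasurable[MeasurableSpace.comap (U t) ⊤ ⊓ mΩ]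
          ((B t).indicator (1 : Ω → ℝ)) :=
        StronglyMeasurable.indicator stronglyMeasurable_one
          (MeasurableSpace.measurableSet_inf.2 ⟨⟨{u}, trivial, rfl⟩, hBm t⟩)
      have := condExp_indep_eq hU' (ℱ.le t) hsm (indep_of_indep_of_le_left (hindep t) inf_le_left)
      rwa [integral_indicator_one (hBm t), hprob t] at this
    have h2 : (s (t + 1)).indicator (1 : Ω → ℝ) = (A t).indicator ((B t).indicator 1) := by
      rw [Set.indicator_indicator]
    rw [h2]
    filter_upwards [condExp_indicator hint (hA t), h1] with ω hω1 hω2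
    rw [hω1]
    by_cases hωA : ω ∈ A t <;> simp [hωA, hω2]
  filter_upwards [ae_mem_limsup_atTop_iff μ hsmeas, ae_all_iff.2 hcond] with ω hω1 hω2 hfreq
  have hlim : ω ∈ limsup s atTop := by
    rw [hω1]
    simp_rw [hω2]
    -- The conditional probabilities are `q` on `A t` and `0` elsewhere, so their sum diverges when
    -- `A t` recurs.
    have := (Set.limsup_eq_tendsto_sum_indicator_atTop hq A).le
      (show ω ∈ limsup A atTop from mem_limsup_iff_frequently_mem.2 hfreq)
    exact this
  rw [mem_limsup_iff_frequently_mem] at hlim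
  rw [frequently_atTop] at hlim ⊢
  intro a
  obtain ⟨t, hat, ht⟩ := hlim (a + 1)
  obtain ⟨t, rfl⟩ : ∃ r, t = r + 1 := ⟨t - 1, by omega⟩
  exact ⟨t, by omega, ht⟩

/-! ### Measurability of the dynamics -/

namespace IsAsyncAveraging

variable {n : ℕ} {Ω : Type*} [mΩ : MeasurableSpace Ω] {μ : Measure Ω} {p : Fin n → ℝ}
  {ℱ : Filtration ℕ mΩ} {G : ℕ → Ω → SimpleGraph (Fin n)} {U : ℕ → Ω → Fin n}
  {x : ℕ → Ω → Fin n → ℝ}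

theorem isAveragingPath (h : IsAsyncAveraging μ p ℱ G U x) (ω : Ω) :
    IsAveragingPath (fun t => G t ω) (fun t => U t ω) (fun t => x t ω) where
  update_selected t := h.update_selected t ω
  update_other t := h.update_other t ω

theorem measurableSet_mem_closedNbhd (h : IsAsyncAveraging μ p ℱ G U x) (t : ℕ) (i j : Fin n) :
    MeasurableSet[ℱ t] {ω | j ∈ closedNbhd (G t ω) i} := by
  simp only [mem_closedNbhd, Set.ofPred_or]
  exact @MeasurableSet.union _ (ℱ t) _ _ (@MeasurableSet.const _ (ℱ t) _) (h.measurable_graph t i j)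

/-- Adaptedness of the states makes the crossing events admissible for Borel–Cantelli. -/
theorem measurable_state (h : IsAsyncAveraging μ p ℱ G U x) (t : ℕ) :
    ∀ i, Measurable[ℱ t] fun ω => x t ω i := by
  classical
  induction t with
  | zero => exact h.measurable_init
  | succ t ih =>
    intro i
    have hle : ℱ t ≤ ℱ (t + 1) := ℱ.mono t.le_succ
    have hstep : (fun ω => x (t + 1) ω i) = fun ω => if U t ω = i then
        (∑ j, if j ∈ closedNbhd (G t ω) i then x t ω j else 0) /
          (∑ j, if j ∈ closedNbhd (G t ω) i then (1 : ℝ) else 0) else x t ω i := by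
      funext ω
      split_ifs with hi
      · subst hi
        rw [h.update_selected t ω, Finset.sum_ite_mem, Finset.univ_inter, Finset.sum_ite_mem,
          Finset.univ_inter, Finset.sum_const, nsmul_one]
      · exact h.update_other t ω i (Ne.symm hi)
    rw [hstep]
    have hmem := fun j => hle _ (h.measurableSet_mem_closedNbhd t i j)
    refine Measurable.ite (h.measurable_select t (measurableSet_singleton i)) ?_
      ((ih i).mono hle le_rfl)
    refine Measurable.div ?_ ?_ <;> refine Finset.measurable_sum _ fun j _ => ?_
    · exact Measurable.ite (hmem j) ((ih j).mono hle le_rfl) measurable_const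
    · exact Measurable.ite (hmem j) measurable_const measurable_const

/-- The event that at time `t` at least `k` agents are below the level `r`, and that `u` is above it
with a neighbour below. -/
theorem measurableSet_crossing (h : IsAsyncAveraging μ p ℱ G U x) (t : ℕ) (r : ℝ) (k : ℕ)
    (u : Fin n) :
    MeasurableSet[ℱ t] {ω | k ≤ (lowerAgents (x t ω) r).card ∧ r < x t ω u ∧
      ∃ v, x t ω v ≤ r ∧ (G t ω).Adj u v} := by
  have hx := h.measurable_state t
  have hG := h.measurable_graph t
  have hle : ∀ i, MeasurableSet[ℱ t] {ω | x t ω i ≤ r} := fun i =>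
    hx i (measurableSet_Iic (a := r))
  have hcard : Measurable[ℱ t] fun ω => (lowerAgents (x t ω) r).card := by
    simp only [lowerAgents, Finset.card_filter]
    exact Finset.measurable_sum _ fun i _ =>
      Measurable.ite (hle i) measurable_const measurable_const
  have h1 : MeasurableSet[ℱ t] {ω | k ≤ (lowerAgents (x t ω) r).card} :=
    hcard (measurableSet_Ici (a := k))
  have h2 : MeasurableSet[ℱ t] {ω | r < x t ω u} := hx u (measurableSet_Ioi (a := r))
  have h3 : MeasurableSet[ℱ t] {ω | ∃ v, x t ω v ≤ r ∧ (G t ω).Adj u v} := by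
    rw [Set.ofPred_exists]
    exact @MeasurableSet.iUnion _ _ (ℱ t) _ _ fun v =>
      @MeasurableSet.inter _ (ℱ t) _ _ (hle v) (hG u v)
  exact @MeasurableSet.inter _ (ℱ t) _ _ h1 (@MeasurableSet.inter _ (ℱ t) _ _ h2 h3)

end IsAsyncAveraging

theorem theorem1 {n : ℕ} {Ω : Type*} [mΩ : MeasurableSpace Ω] (μ : Measure Ω)
    [IsProbabilityMeasure μ] (p : Fin n → ℝ) (ℱ : Filtration ℕ mΩ)
    (G : ℕ → Ω → SimpleGraph (Fin n)) (U : ℕ → Ω → Fin n) (x : ℕ → Ω → Fin n → ℝ)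
    (hmodel : IsAsyncAveraging μ p ℱ G U x)
    (hconn : ∀ᵐ ω ∂μ, ∃ᶠ t in atTop, (G t ω).Connected) :
    ∃ xlim : Ω → ℝ, Measurable xlim ∧
      ∀ᵐ ω ∂μ, ∀ i, Tendsto (fun t => x t ω i) atTop (𝓝 (xlim ω)) := by
  obtain ⟨ω₀⟩ := nonempty_of_isProbabilityMeasure μ
  have hsel : ∀ᵐ ω ∂μ, ∀ (r : ℚ) (k : ℕ) (u : Fin n),
      (∃ᶠ t in atTop, k ≤ (lowerAgents (x t ω) r).card ∧ (r : ℝ) < x t ω u ∧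
        ∃ v, x t ω v ≤ r ∧ (G t ω).Adj u v) →
      ∃ᶠ t in atTop, (k ≤ (lowerAgents (x t ω) r).card ∧ (r : ℝ) < x t ω u ∧
        ∃ v, x t ω v ≤ r ∧ (G t ω).Adj u v) ∧ U t ω = u := by
    -- Only countably many triples occur, so one null set suffices.
    simp only [ae_all_iff]
    intro r k u
    exact ae_frequently_and_eq_of_frequently μ ℱ hmodel.measurable_select hmodel.indep_select
      (fun t => hmodel.prob_select t u) (hmodel.prob_pos u)
      (fun t => hmodel.measurableSet_crossing t r k u)
  -- `U 0 ω₀` merely names some agent; the `limsup` is measurable even where convergence fails.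
  refine ⟨fun ω => limsup (fun t => x t ω (U 0 ω₀)) atTop,
    Measurable.limsup fun t => (hmodel.measurable_state t _).mono (ℱ.le t) le_rfl, ?_⟩
  filter_upwards [hconn, hsel] with ω hω hselω
  obtain ⟨l, hl⟩ := (hmodel.isAveragingPath ω).exists_tendsto (U 0 ω₀).pos hω hselω
  rw [(hl (U 0 ω₀)).limsup_eq]
  exact hl
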